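/- Let $p\ge 1$ and $n\ge 2p+2$ be integers. Let $C_n$ be the cycle graph on the vertex set $\{0,1,\dots,n-1\}$, and let $C_n^p$ be its $p$-th power: the graph on the same vertices in which two distinct vertices are adjacent if and only if $C_n$ contains a path of length at most $p$ between them. For a finite graph $G$, let $\Delta_2^t(G)$ be the total $2$-cut complex of $G$, i.e. the simplicial complex whose facets are the sets $\sigma\subseteq V(G)$ such that $|\sigma|=|V(G)|-2$ and the induced subgraph $G[V(G)\setminus\sigma]$ has no edge. Then (the geometric realization of) $\Delta_2^t(C_n^p)$ satisfies $$\Delta_2^t(C_n^p)\simeq\begin{cases}\mathbb{S}^{\frac{n-4}{2}} & \text{if } n=2p+2,\\ \mathbb{S}^{n-4} & \text{if } n\ge 3p+1,\end{cases}$$ where $\simeq$ denotes homotopy equivalence and $\mathbb{S}^d$ is the $d$-dimensional sphere. -/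

import Mathlib

open scoped ContinuousMap

/-- The `p`-th power of a graph `G`: same vertices, and two distinct vertices are adjacent iff
`G` has a path between them of length at most `p`. -/
def SimpleGraph.pathPower {V : Type*} (G : SimpleGraph V) (p : ℕ) : SimpleGraph V where
  Adj u v := u ≠ v ∧ ∃ w : G.Walk u v, w.IsPath ∧ w.length ≤ p
  symm := ⟨fun _ _ h => ⟨h.1.symm, by
    obtain ⟨w, hw, hl⟩ := h.2
    exact ⟨w.reverse, hw.reverse, by simpa using hl⟩⟩⟩
  loopless := ⟨fun _ h => h.1 rfl⟩

/-- `σ` is a generating simplex of the total `k`-cut complex of `G`: it has `|V(G)| - k` vertices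
(written without truncated subtraction) and the subgraph induced on its complement has no edge. -/
def IsTotalCutFacet {V : Type*} [Fintype V] (G : SimpleGraph V) (k : ℕ) (σ : Finset V) : Prop :=
  σ.card + k = Fintype.card V ∧ G.IsIndepSet ((σ : Set V)ᶜ)

/-- The total `k`-cut complex of a finite graph `G`: the simplicial complex whose facets are the
sets `σ` as above. Following Mathlib's convention, the empty simplex is not listed among the faces
(it contributes no point to the geometric realization). -/
def totalCutComplex {V : Type*} [Fintype V] (k : ℕ) (G : SimpleGraph V) :
    PreAbstractSimplicialComplex V where
  faces := {τ | τ.Nonempty ∧ ∃ σ, IsTotalCutFacet G k σ ∧ τ ⊆ σ}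
  isRelLowerSet_faces := fun _ h =>
    ⟨h.1, fun _ hb hne => ⟨hne, h.2.imp fun _ hσ => ⟨hσ.1, hb.trans hσ.2⟩⟩⟩

/-- The geometric realization, in barycentric coordinates, of a simplicial complex on a finite
vertex set `V`: the points of the standard simplex in `V → ℝ` that are supported on a face, with
the subspace topology. -/
def geometricRealization {V : Type*} [Fintype V] (K : PreAbstractSimplicialComplex V) :
    Set (V → ℝ) :=
  {x | x ∈ stdSimplex ℝ V ∧ ∃ τ ∈ K.faces, ∀ v, x v ≠ 0 → v ∈ τ}

/-- The unit sphere `S^d` in `ℝ^(d+1)`. -/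
abbrev unitSphere (d : ℕ) : Set (EuclideanSpace ℝ (Fin (d + 1))) :=
  Metric.sphere 0 1

/-!
The complex `Δ` consists of the nonempty sets whose complement contains two nonadjacent vertices.
After forgetting the normalisation `∑ h = 1`, a point of its realization is a nonzero function
`h ≥ 0` on the vertices that vanishes at two nonadjacent vertices (`vanishingCone`). Adjacency in
the power of the cycle is a condition on cyclic distances, so only the cones of functions vanishing
at two vertices of cyclic distance greater than `p` have to be studied. All homotopies below are
straight-line homotopies in a space of functions (`nonempty_homotopyEquiv_of_segment_subset`).

* For `p = 1` and `n ≥ 4`, let `U` be the 3-dimensional space of quadratic polynomials on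
  `{0, …, n - 1}`. The points `(j, j²)` form a convex polygon, so each edge `{i, i + 1}` of the cycle
  is the zero set of some nonnegative element of `U`. Starting from `h ≥ 0` outside `U` and greedily
  subtracting multiples of these `n` elements gives a function in the class `h + U`, hence nonzero,
  whose zero set lies in no edge, i.e. contains two nonadjacent vertices. Nonzero elements of `U`
  are not in the cone. Hence the cone is equivalent to `{h ≥ 0, h ∉ U}`, which is equivalent to
  `{h ∉ U}`, since `U` contains the constants, and so to the unit sphere of dimension
  `n - 3 - 1`.
* If `n ≥ 3 (p + 1) + 1`, the inclusion of the cone for `p + 1` into the cone for `p` is an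
  equivalence. The functions to be pushed away vanish at the two ends of a unique arc `A` of
  `p + 2` vertices and nowhere outside it; one lowers the values outside `A` by their minimum and
  raises the value at an interior vertex of `A`, which is a collapse of the corresponding faces
  (`arcShift`). Induction on `p` gives the case `n ≥ 3 p + 1`.
* If `n = 2 p + 2`, two vertices are nonadjacent precisely when they are antipodal. Adding up the
  values at antipodes makes the cone equivalent to the functions on `p + 1` points with minimum `0`
  that are not identically `0`, and these are equivalent to the nonconstant functions, i.e. to the
  complement of a line in `ℝ ^ (p + 1)`.
-/

/-! ### Straight-line homotopy equivalences -/

/-- A self-map moving each point along a segment inside the space is homotopic to the identity. -/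
theorem homotopic_id_of_segment_subset {E : Type*} [NormedAddCommGroup E] [NormedSpace ℝ E]
    {X : Set E} (k : C(X, X)) (hk : ∀ x : X, segment ℝ (x : E) (k x) ⊆ X) :
    k.Homotopic (ContinuousMap.id X) := by
  refine ContinuousMap.Homotopic.symm ⟨⟨⟨fun q ↦ ⟨AffineMap.lineMap (q.2 : E) (k q.2 : E)
    (q.1 : ℝ), ?_⟩, ?_⟩, ?_, ?_⟩⟩
  · refine hk q.2 ?_
    rw [segment_eq_image_lineMap]
    exact ⟨q.1, q.1.2, rfl⟩
  · refine Continuous.subtype_mk ?_ _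
    simp only [AffineMap.lineMap_apply_module]
    fun_prop
  · intro x
    ext
    simp
  · intro x
    ext
    simp

/-- Two maps whose composites move every point along a segment inside the respective set are
homotopy inverse to each other. -/
theorem nonempty_homotopyEquiv_of_segment_subset {E F : Type*}
    [NormedAddCommGroup E] [NormedSpace ℝ E] [NormedAddCommGroup F] [NormedSpace ℝ F]
    {X : Set E} {Y : Set F} {f : E → F} {g : F → E}
    (hf : ContinuousOn f X) (hg : ContinuousOn g Y)
    (hfX : Set.MapsTo f X Y) (hgY : Set.MapsTo g Y X)
    (hX : ∀ x ∈ X, segment ℝ x (g (f x)) ⊆ X) (hY : ∀ y ∈ Y, segment ℝ y (f (g y)) ⊆ Y) :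
    Nonempty (X ≃ₕ Y) := by
  let f' : C(X, Y) := ⟨hfX.restrict f X Y, hf.mapsToRestrict hfX⟩
  let g' : C(Y, X) := ⟨hgY.restrict g Y X, hg.mapsToRestrict hgY⟩
  exact ⟨⟨f', g', homotopic_id_of_segment_subset (g'.comp f') fun x ↦ hX x x.2,
    homotopic_id_of_segment_subset (f'.comp g') fun y ↦ hY y y.2⟩⟩

theorem nonempty_homotopyEquiv_trans {X Y Z : Type*} [TopologicalSpace X] [TopologicalSpace Y]
    [TopologicalSpace Z] (h₁ : Nonempty (X ≃ₕ Y)) (h₂ : Nonempty (Y ≃ₕ Z)) :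
    Nonempty (X ≃ₕ Z) :=
  ⟨h₁.some.trans h₂.some⟩

theorem segment_subset_compl_of_sub_mem {E : Type*} [AddCommGroup E] [Module ℝ E]
    {U : Submodule ℝ E} {x y : E} (hx : x ∉ U) (hxy : y - x ∈ U) :
    segment ℝ x y ⊆ {z | z ∉ U} := by
  rw [segment_eq_image']
  rintro _ ⟨t, -, rfl⟩ hmem
  exact hx ((U.add_mem_iff_left (U.smul_mem t hxy)).1 hmem)

/-- The complement of a subspace `U` is homotopy equivalent to the unit sphere of the quotient
by `U`, through normalisation of the class modulo `U`. -/
theorem nonempty_compl_submodule_homotopyEquiv_unitSphere {ι : Type*} [Fintype ι]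
    (U : Submodule ℝ (ι → ℝ)) (d : ℕ) (hd : Module.finrank ℝ U + (d + 1) = Fintype.card ι) :
    Nonempty ({h : ι → ℝ | h ∉ U} ≃ₕ unitSphere d) := by
  have hq : Module.finrank ℝ ((ι → ℝ) ⧸ U) = Module.finrank ℝ (EuclideanSpace ℝ (Fin (d + 1))) := by
    have := U.finrank_quotient_add_finrank
    rw [Module.finrank_fintype_fun_eq_card] at this
    rw [finrank_euclideanSpace_fin]
    omega
  let e := LinearEquiv.ofFinrankEq _ _ hq
  let L : (ι → ℝ) →ₗ[ℝ] EuclideanSpace ℝ (Fin (d + 1)) := e.toLinearMap ∘ₗ U.mkQ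
  have hL : ∀ h, L h = 0 ↔ h ∈ U := fun h ↦ by simp [L]
  obtain ⟨s, hs⟩ := L.exists_rightInverse_of_surjective
    (LinearMap.range_eq_top.2 (e.surjective.comp U.mkQ_surjective))
  have hLs : ∀ y, L (s y) = y := fun y ↦ LinearMap.congr_fun hs y
  have hLc : Continuous L := L.continuous_of_finiteDimensional
  have hsc : Continuous s := s.continuous_of_finiteDimensional
  refine nonempty_homotopyEquiv_of_segment_subset (f := fun h ↦ ‖L h‖⁻¹ • L h) (g := s) ?_
    hsc.continuousOn ?_ ?_ ?_ ?_
  · refine ContinuousOn.smul (ContinuousOn.inv₀ hLc.norm.continuousOn fun h hh ↦ ?_)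
      hLc.continuousOn
    exact norm_ne_zero_iff.2 (mt (hL h).1 hh)
  · intro h hh
    have : ‖L h‖ ≠ 0 := norm_ne_zero_iff.2 (mt (hL h).1 hh)
    simp [norm_smul, this]
  · intro y hy hmem
    rw [← hL, hLs] at hmem
    simp [hmem] at hy
  · rintro h hh _ ⟨a, b, ha, hb, hab, rfl⟩ hmem
    have hpos : 0 < ‖L h‖ := norm_pos_iff.2 (mt (hL h).1 hh)
    rw [← hL, map_add, map_smul, map_smul, hLs, smul_smul, ← add_smul, smul_eq_zero] at hmem
    rcases hmem with h0 | h0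
    -- A vanishing point of the segment forces `a + b * ‖L h‖⁻¹ = 0` with nonnegative summands.
    · have hi := inv_pos.2 hpos
      have : 0 ≤ b * ‖L h‖⁻¹ := by positivity
      have ha0 : a = 0 := by linarith
      have hb1 : b = 1 := by linarith
      rw [ha0, hb1] at h0
      linarith
    · exact hh ((hL h).1 h0)
  · intro y hy
    have : ‖y‖ = 1 := by simpa using hy
    simp only [hLs, this, inv_one, one_smul, segment_same]
    simpa using hy

/-! ### The cone over the realization -/

/-- The nonnegative, not identically zero functions that vanish at two points related by `R`. When
`R` is nonadjacency in `G`, this is the cone, without its apex, over the realization of the total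
2-cut complex of `G`. -/
def vanishingCone {V : Type*} [Fintype V] (R : V → V → Prop) : Set (V → ℝ) :=
  {h | 0 ≤ h ∧ 0 < ∑ v, h v ∧ ∃ u v, R u v ∧ h u = 0 ∧ h v = 0}

theorem segment_subset_vanishingCone {V : Type*} [Fintype V] {R : V → V → Prop} {x y : V → ℝ}
    (hx : 0 ≤ x) (hx' : 0 < ∑ v, x v) (hy : 0 ≤ y) (hy' : 0 < ∑ v, y v) {u v : V} (huv : R u v)
    (hxu : x u = 0) (hxv : x v = 0) (hyu : y u = 0) (hyv : y v = 0) :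
    segment ℝ x y ⊆ vanishingCone R := by
  rintro _ ⟨a, b, ha, hb, hab, rfl⟩
  refine ⟨add_nonneg (smul_nonneg ha hx) (smul_nonneg hb hy), ?_, u, v, huv, ?_, ?_⟩
  · simp only [Pi.add_apply, Pi.smul_apply, smul_eq_mul, Finset.sum_add_distrib, ← Finset.mul_sum]
    rcases ha.eq_or_lt with rfl | ha
    · have : b = 1 := by linarith
      simpa [this] using hy'
    · have := mul_pos ha hx'
      have := mul_nonneg hb hy'.le
      linarith
  · simp [hxu, hyu]
  · simp [hxv, hyv]

/-- The complement of a facet is a nonadjacent pair, so a point of the simplex lies in the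
realization iff it vanishes at such a pair. -/
theorem mem_geometricRealization_totalCutComplex_two_iff {V : Type*} [Fintype V]
    (G : SimpleGraph V) (x : V → ℝ) :
    x ∈ geometricRealization (totalCutComplex 2 G) ↔
      x ∈ stdSimplex ℝ V ∧ ∃ u v, (u ≠ v ∧ ¬ G.Adj u v) ∧ x u = 0 ∧ x v = 0 := by
  classical
  refine and_congr_right fun hx ↦ ⟨?_, ?_⟩
  · rintro ⟨τ, ⟨-, σ, ⟨hcard, hind⟩, hτσ⟩, hsupp⟩
    have hc : σᶜ.card = 2 := by rw [Finset.card_compl]; omega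
    obtain ⟨u, v, huv, hσ⟩ := Finset.card_eq_two.1 hc
    have hu : u ∉ σ := by rw [← Finset.mem_compl, hσ]; simp
    have hv : v ∉ σ := by rw [← Finset.mem_compl, hσ]; simp
    refine ⟨u, v, ⟨huv, hind (by simpa using hu) (by simpa using hv) huv⟩, ?_, ?_⟩
    · by_contra h
      exact hu (hτσ (hsupp u h))
    · by_contra h
      exact hv (hτσ (hsupp v h))
  · rintro ⟨u, v, ⟨huv, hadj⟩, hu, hv⟩
    refine ⟨Finset.univ.filter fun w ↦ x w ≠ 0, ⟨?_, {u, v}ᶜ, ⟨?_, ?_⟩, ?_⟩, fun w hw ↦ by simpa⟩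
    · by_contra hne
      rw [Finset.not_nonempty_iff_eq_empty, Finset.filter_eq_empty_iff] at hne
      have : ∑ w, x w = 0 := Finset.sum_eq_zero fun w hw ↦ not_not.1 (hne hw)
      rw [hx.2] at this
      exact one_ne_zero this
    · rw [Finset.card_compl, Finset.card_pair huv]
      have := Finset.card_le_univ {u, v}
      rw [Finset.card_pair huv] at this
      omega
    · have : ((({u, v}ᶜ : Finset V) : Set V)ᶜ) = {u, v} := by
        rw [Finset.coe_compl, compl_compl, Finset.coe_pair]
      rw [this, SimpleGraph.isIndepSet_iff, Set.pairwise_pair]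
      exact fun _ ↦ ⟨hadj, fun h ↦ hadj h.symm⟩
    · intro w hw
      have hw' : x w ≠ 0 := by simpa using hw
      rw [Finset.mem_compl, Finset.mem_insert, Finset.mem_singleton]
      rintro (rfl | rfl)
      · exact hw' hu
      · exact hw' hv

theorem nonempty_realization_homotopyEquiv_vanishingCone {V : Type*} [Fintype V]
    (G : SimpleGraph V) :
    Nonempty (geometricRealization (totalCutComplex 2 G) ≃ₕ
      vanishingCone fun u v ↦ u ≠ v ∧ ¬ G.Adj u v) := by
  have hnorm : ∀ h ∈ vanishingCone fun u v ↦ u ≠ v ∧ ¬ G.Adj u v,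
      (∑ v, h v)⁻¹ • h ∈ geometricRealization (totalCutComplex 2 G) := by
    rintro h ⟨h0, hs, u, v, huv, hu, hv⟩
    refine (mem_geometricRealization_totalCutComplex_two_iff G _).2 ⟨⟨fun w ↦ ?_, ?_⟩, u, v, huv, ?_, ?_⟩
    · exact mul_nonneg (inv_nonneg.2 hs.le) (h0 w)
    · simp only [Pi.smul_apply, smul_eq_mul, ← Finset.mul_sum]
      exact inv_mul_cancel₀ hs.ne'
    · simp [hu]
    · simp [hv]
  have hincl : geometricRealization (totalCutComplex 2 G) ⊆
      vanishingCone fun u v ↦ u ≠ v ∧ ¬ G.Adj u v := by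
    intro x hx
    obtain ⟨hx, h⟩ := (mem_geometricRealization_totalCutComplex_two_iff G x).1 hx
    exact ⟨hx.1, by rw [hx.2]; exact one_pos, h⟩
  refine nonempty_homotopyEquiv_of_segment_subset (f := id) (g := fun h ↦ (∑ v, h v)⁻¹ • h)
    continuousOn_id ?_ hincl hnorm ?_ ?_
  · have hsum : Continuous fun h : V → ℝ ↦ ∑ v, h v := by fun_prop
    exact (hsum.continuousOn.inv₀ fun h hh ↦ hh.2.1.ne').smul continuousOn_id
  · intro x hx
    have : ∑ v, x v = 1 := hx.1.2
    simpa [this] using hx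
  · intro h hh
    have hh' := hincl (hnorm h hh)
    obtain ⟨h0, hs, u, v, huv, hu, hv⟩ := hh
    exact segment_subset_vanishingCone h0 hs hh'.1 hh'.2.1 huv hu hv (by simp [hu]) (by simp [hv])

/-! ### Powers of cycles -/

/-- The number of steps `i ↦ i + 1` on the cycle that lead from `i` to `j`. -/
def clockwiseDist {n : ℕ} (i j : Fin n) : ℕ :=
  if (i : ℕ) ≤ j then (j : ℕ) - i else (j : ℕ) + n - i

theorem exists_clockwiseDist_eq {n : ℕ} (i : Fin n) {k : ℕ} (hk : k < n) :
    ∃ j : Fin n, clockwiseDist i j = k := by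
  have hi := i.2
  by_cases h : (i : ℕ) + k < n
  · exact ⟨⟨i + k, h⟩, by simp [clockwiseDist]⟩
  · refine ⟨⟨i + k - n, by omega⟩, ?_⟩
    simp only [clockwiseDist]
    split_ifs <;> omega

theorem cycleGraph_adj_iff_clockwiseDist {n : ℕ} (i j : Fin n) :
    (SimpleGraph.cycleGraph n).Adj i j ↔ clockwiseDist i j = 1 ∨ clockwiseDist j i = 1 := by
  rw [SimpleGraph.cycleGraph_adj', Fin.val_sub, Fin.val_sub]
  have hi := i.2
  have hj := j.2
  have key : ∀ a b : Fin n, (n - (b : ℕ) + a) % n = clockwiseDist b a := by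
    intro a b
    have ha := a.2
    have hb := b.2
    unfold clockwiseDist
    split_ifs with h
    · rw [show n - (b : ℕ) + a = (a - b) + n by omega, Nat.add_mod_right, Nat.mod_eq_of_lt (by omega)]
    · rw [Nat.mod_eq_of_lt (by omega)]
      omega
  rw [key, key, or_comm]

theorem clockwiseDist_le_of_walk {n : ℕ} {i j : Fin n}
    (w : (SimpleGraph.cycleGraph n).Walk i j) :
    clockwiseDist i j ≤ w.length ∨ clockwiseDist j i ≤ w.length := by
  induction w with
  | nil => simp [clockwiseDist]
  | @cons i j k hij w ih =>
    rw [cycleGraph_adj_iff_clockwiseDist] at hij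
    rw [SimpleGraph.Walk.length_cons]
    have hi := i.2
    have hj := j.2
    have hk := k.2
    unfold clockwiseDist at *
    split_ifs at * <;> omega

theorem exists_walk_length_eq_clockwiseDist {n : ℕ} (i : Fin n) (k : ℕ) :
    ∀ j : Fin n, clockwiseDist i j = k →
      ∃ w : (SimpleGraph.cycleGraph n).Walk i j, w.length = k := by
  have hi := i.2
  induction k with
  | zero =>
    intro j hj
    have hj' := j.2
    obtain rfl : i = j := by
      ext
      unfold clockwiseDist at hj
      split_ifs at hj <;> omega
    exact ⟨.nil, rfl⟩
  | succ k ih =>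
    intro j hj
    have hj' := j.2
    have hk : k < n := by
      unfold clockwiseDist at hj
      split_ifs at hj <;> omega
    obtain ⟨l, hl⟩ := exists_clockwiseDist_eq i hk
    obtain ⟨w, hw⟩ := ih l hl
    have hl' := l.2
    have hadj : (SimpleGraph.cycleGraph n).Adj l j := by
      rw [cycleGraph_adj_iff_clockwiseDist]
      left
      unfold clockwiseDist at *
      split_ifs at * <;> omega
    exact ⟨w.concat hadj, by rw [SimpleGraph.Walk.length_concat, hw]⟩

theorem pathPower_cycleGraph_adj_iff {n : ℕ} (p : ℕ) (i j : Fin n) :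
    ((SimpleGraph.cycleGraph n).pathPower p).Adj i j ↔
      i ≠ j ∧ (clockwiseDist i j ≤ p ∨ clockwiseDist j i ≤ p) := by
  refine and_congr_right fun _ ↦ ⟨?_, ?_⟩
  · rintro ⟨w, -, hw⟩
    exact (clockwiseDist_le_of_walk w).imp hw.trans' hw.trans'
  · rintro (h | h)
    · obtain ⟨w, hw⟩ := exists_walk_length_eq_clockwiseDist i _ j rfl
      exact ⟨w.bypass, w.bypass_isPath, (w.length_bypass_le_length).trans (hw.le.trans h)⟩
    · obtain ⟨w, hw⟩ := exists_walk_length_eq_clockwiseDist j _ i rfl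
      exact ⟨w.reverse.bypass, w.reverse.bypass_isPath, (w.reverse.length_bypass_le_length).trans
        (by rw [SimpleGraph.Walk.length_reverse]; exact hw.le.trans h)⟩

/-- Both arcs between `u` and `v` have more than `p` edges. -/
def CyclicallyFar {n : ℕ} (p : ℕ) (u v : Fin n) : Prop :=
  p < clockwiseDist u v ∧ p < clockwiseDist v u

theorem ne_and_not_pathPower_adj_iff {n : ℕ} (p : ℕ) (u v : Fin n) :
    (u ≠ v ∧ ¬ ((SimpleGraph.cycleGraph n).pathPower p).Adj u v) ↔ CyclicallyFar p u v := by
  rw [pathPower_cycleGraph_adj_iff, CyclicallyFar]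
  constructor
  · rintro ⟨h, h'⟩
    simpa [h] using h'
  · rintro ⟨h, h'⟩
    refine ⟨?_, fun H ↦ by omega⟩
    rintro rfl
    simp [clockwiseDist] at h

/-! ### Passing from distance `p` to distance `p + 1` -/

/-- The vertices outside the arc of `q + 1` vertices that starts at `i`. -/
def farSet {n : ℕ} (q : ℕ) (i : Fin n) : Finset (Fin n) :=
  Finset.univ.filter fun j ↦ q < clockwiseDist i j

theorem mem_farSet {n q : ℕ} {i j : Fin n} : j ∈ farSet q i ↔ q < clockwiseDist i j := by
  simp [farSet]

theorem farSet_nonempty {n q : ℕ} (hq : q + 1 < n) (i : Fin n) : (farSet q i).Nonempty := by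
  obtain ⟨j, hj⟩ := exists_clockwiseDist_eq i hq
  exact ⟨j, mem_farSet.2 (by omega)⟩

/-- The indicator of the complement of the arc of `q + 1` vertices starting at `i`, minus the
indicator of the second vertex of that arc. -/
def shiftDirection {n : ℕ} (q : ℕ) (i : Fin n) : Fin n → ℝ := fun j ↦
  if q < clockwiseDist i j then 1 else if clockwiseDist i j = 1 then -1 else 0

/-- For each arc of `q + 1` vertices, subtract the minimum of `h` outside the arc from the values
outside, and add it to the value at the second vertex of the arc. For the functions it is applied to,
at most one of these minima is nonzero. -/
noncomputable def arcShift {n q : ℕ} (hq : q + 1 < n) (h : Fin n → ℝ) : Fin n → ℝ :=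
  h - ∑ i, (farSet q i).inf' (farSet_nonempty hq i) h • shiftDirection q i

theorem continuous_arcShift {n q : ℕ} (hq : q + 1 < n) : Continuous (arcShift hq) := by
  refine continuous_id.sub (continuous_finsetSum _ fun i _ ↦ ?_)
  have hc : Continuous fun h : Fin n → ℝ ↦ (farSet q i).inf' (farSet_nonempty hq i) h :=
    Continuous.finset_inf'_apply _ fun j _ ↦ continuous_apply j
  exact hc.smul continuous_const

theorem inf'_farSet_nonneg {n q : ℕ} (hq : q + 1 < n) {h : Fin n → ℝ} (h0 : 0 ≤ h) (i : Fin n) :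
    0 ≤ (farSet q i).inf' (farSet_nonempty hq i) h :=
  Finset.le_inf' _ _ fun j _ ↦ h0 j

theorem arcShift_eq_self {n q : ℕ} (hq : q + 1 < n) {h : Fin n → ℝ}
    (hc : ∀ i, (farSet q i).inf' (farSet_nonempty hq i) h = 0) : arcShift hq h = h := by
  simp [arcShift, hc]

theorem lt_of_mem_farSet_inf'_pos {n q : ℕ} (hq : q + 1 < n) {h : Fin n → ℝ} {i u : Fin n}
    (hi : 0 < (farSet q i).inf' (farSet_nonempty hq i) h) (hu : h u = 0) :
    clockwiseDist i u ≤ q := by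
  by_contra! hlt
  have := Finset.inf'_le (s := farSet q i) h (mem_farSet.2 hlt)
  linarith

theorem arcShift_eq_of_far_succ {n q : ℕ} (hq : q + 1 < n) {h : Fin n → ℝ} (h0 : 0 ≤ h)
    {u v : Fin n} (huv : CyclicallyFar q u v) (hu : h u = 0) (hv : h v = 0) :
    arcShift hq h = h := by
  refine arcShift_eq_self hq fun i ↦ (inf'_farSet_nonneg hq h0 i).antisymm' ?_
  by_contra! hi
  have h1 := lt_of_mem_farSet_inf'_pos hq hi hu
  have h2 := lt_of_mem_farSet_inf'_pos hq hi hv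
  obtain ⟨h3, h4⟩ := huv
  have := i.2
  have := u.2
  have := v.2
  unfold clockwiseDist at *
  split_ifs at * <;> omega

theorem CyclicallyFar.symm {n p : ℕ} {u v : Fin n} (h : CyclicallyFar p u v) :
    CyclicallyFar p v u :=
  ⟨h.2, h.1⟩

/-- A vertex `k` off an arc of length `q` is far from one of the ends `u`, `v` of the arc, since
otherwise the cycle would be covered by three arcs of length at most `q`. -/
theorem cyclicallyFar_of_lt_of_eq {n q : ℕ} (hq : 1 ≤ q) (hn : 3 * q + 1 ≤ n) {u v k : Fin n}
    (huv : clockwiseDist u v = q) (hk : q < clockwiseDist u k) :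
    CyclicallyFar q u k ∨ CyclicallyFar q v k := by
  have := u.2
  have := v.2
  have := k.2
  unfold CyclicallyFar
  unfold clockwiseDist at *
  split_ifs at * <;> omega

/-- If `h` vanishes at both ends of an arc of length `q`, no other arc of that length contains both
zeros, so only this arc contributes to `arcShift`. -/
theorem arcShift_eq_of_clockwiseDist_eq {n q : ℕ} (hn : 3 * q + 1 ≤ n) (hq : q + 1 < n)
    {h : Fin n → ℝ} (h0 : 0 ≤ h) {u v : Fin n} (huv : clockwiseDist u v = q)
    (hu : h u = 0) (hv : h v = 0) :
    arcShift hq h = h - (farSet q u).inf' (farSet_nonempty hq u) h • shiftDirection q u := by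
  rw [arcShift, Finset.sum_eq_single u]
  · intro i _ hi
    rw [(inf'_farSet_nonneg hq h0 i).antisymm' _, zero_smul]
    by_contra! hpos
    have h1 := lt_of_mem_farSet_inf'_pos hq hpos hu
    have h2 := lt_of_mem_farSet_inf'_pos hq hpos hv
    have hi' : (i : ℕ) ≠ u := fun H ↦ hi (Fin.ext H)
    have := i.2
    have := u.2
    have := v.2
    unfold clockwiseDist at *
    split_ifs at * <;> omega
  · simp

theorem arcShift_spec_of_clockwiseDist_eq {n q : ℕ} (hq2 : 2 ≤ q) (hn : 3 * q + 1 ≤ n)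
    (hq : q + 1 < n) {h : Fin n → ℝ} (h0 : 0 ≤ h) (hs : 0 < ∑ v, h v) {u v : Fin n}
    (huv : clockwiseDist u v = q) (hu : h u = 0) (hv : h v = 0) :
    0 ≤ arcShift hq h ∧ 0 < ∑ w, arcShift hq h w ∧ arcShift hq h u = 0 ∧ arcShift hq h v = 0 ∧
      ∃ u' v', CyclicallyFar q u' v' ∧ arcShift hq h u' = 0 ∧ arcShift hq h v' = 0 := by
  rw [arcShift_eq_of_clockwiseDist_eq hn hq h0 huv hu hv]
  -- `k` is a vertex off the arc at which `h` is minimal; it becomes a zero.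
  have hc0 := inf'_farSet_nonneg hq h0 u
  obtain ⟨k, hk, hck⟩ := Finset.exists_mem_eq_inf' (farSet_nonempty hq u) h
  have hle : ∀ j ∈ farSet q u, (farSet q u).inf' (farSet_nonempty hq u) h ≤ h j :=
    fun j hj ↦ Finset.inf'_le h hj
  generalize (farSet q u).inf' (farSet_nonempty hq u) h = c at *
  have hk' := mem_farSet.1 hk
  have hr0 : 0 ≤ h - c • shiftDirection q u := by
    intro j
    have hj := h0 j
    simp only [Pi.zero_apply, Pi.sub_apply, Pi.smul_apply, smul_eq_mul, shiftDirection] at hj ⊢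
    split_ifs with h1 h2
    · have := hle j (mem_farSet.2 h1)
      linarith
    · linarith
    · linarith
  have hru : (h - c • shiftDirection q u) u = 0 := by
    simp [shiftDirection, clockwiseDist, hu]
  have hrv : (h - c • shiftDirection q u) v = 0 := by
    simp [shiftDirection, huv, hv, show q ≠ 1 by omega]
  have hrk : (h - c • shiftDirection q u) k = 0 := by
    simp [shiftDirection, hk', hck]
  refine ⟨hr0, ?_, hru, hrv, ?_⟩
  · rcases hc0.eq_or_lt with rfl | hc
    · simpa using hs
    -- If something was subtracted, the value at the second vertex of the arc has increased.
    · obtain ⟨s, hs1⟩ := exists_clockwiseDist_eq u (k := 1) (by omega)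
      refine Finset.sum_pos' (fun j _ ↦ hr0 j) ⟨s, Finset.mem_univ s, ?_⟩
      have := h0 s
      simp only [Pi.zero_apply, Pi.sub_apply, Pi.smul_apply, smul_eq_mul, shiftDirection, hs1,
        if_neg (show ¬ q < 1 by omega), if_true] at this ⊢
      linarith
  · rcases cyclicallyFar_of_lt_of_eq (by omega) hn huv hk' with H | H
    · exact ⟨u, k, H, hru, hrk⟩
    · exact ⟨v, k, H, hrv, hrk⟩

theorem arcShift_spec {n p : ℕ} (hp : 1 ≤ p) (hn : 3 * (p + 1) + 1 ≤ n) (hq : p + 1 + 1 < n)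
    {h : Fin n → ℝ} (h0 : 0 ≤ h) (hs : 0 < ∑ v, h v) {u v : Fin n} (huv : CyclicallyFar p u v)
    (hu : h u = 0) (hv : h v = 0) :
    0 ≤ arcShift hq h ∧ 0 < ∑ w, arcShift hq h w ∧ arcShift hq h u = 0 ∧ arcShift hq h v = 0 ∧
      ∃ u' v', CyclicallyFar (p + 1) u' v' ∧ arcShift hq h u' = 0 ∧ arcShift hq h v' = 0 := by
  obtain ⟨h1, h2⟩ := huv
  rcases (Nat.succ_le_of_lt h1).eq_or_lt with h1 | h1
  · exact arcShift_spec_of_clockwiseDist_eq (by omega) hn hq h0 hs h1.symm hu hv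
  rcases (Nat.succ_le_of_lt h2).eq_or_lt with h2 | h2
  · obtain ⟨a, b, c, d, e⟩ :=
      arcShift_spec_of_clockwiseDist_eq (by omega) hn hq h0 hs h2.symm hv hu
    exact ⟨a, b, d, c, e⟩
  · rw [arcShift_eq_of_far_succ hq h0 ⟨h1, h2⟩ hu hv]
    exact ⟨h0, hs, hu, hv, u, v, ⟨h1, h2⟩, hu, hv⟩

theorem nonempty_vanishingCone_cyclicallyFar_succ {n p : ℕ} (hp : 1 ≤ p)
    (hn : 3 * (p + 1) + 1 ≤ n) :
    Nonempty (vanishingCone (CyclicallyFar (n := n) (p + 1)) ≃ₕ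
      vanishingCone (CyclicallyFar (n := n) p)) := by
  have hq : p + 1 + 1 < n := by omega
  have hmono : vanishingCone (CyclicallyFar (n := n) (p + 1)) ⊆
      vanishingCone (CyclicallyFar (n := n) p) := by
    rintro h ⟨h0, hs, u, v, huv, hu, hv⟩
    exact ⟨h0, hs, u, v, ⟨by have := huv.1; omega, by have := huv.2; omega⟩, hu, hv⟩
  refine nonempty_homotopyEquiv_of_segment_subset (f := id) (g := arcShift hq) continuousOn_id
    (continuous_arcShift hq).continuousOn hmono ?_ ?_ ?_
  · rintro h ⟨h0, hs, u, v, huv, hu, hv⟩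
    obtain ⟨h1, h2, -, -, h3⟩ := arcShift_spec hp hn hq h0 hs huv hu hv
    exact ⟨h1, h2, h3⟩
  · rintro h ⟨h0, hs, u, v, huv, hu, hv⟩
    rw [id, arcShift_eq_of_far_succ hq h0 huv hu hv, segment_same, Set.singleton_subset_iff]
    exact ⟨h0, hs, u, v, huv, hu, hv⟩
  · rintro h ⟨h0, hs, u, v, huv, hu, hv⟩
    obtain ⟨h1, h2, h3, h4, -⟩ := arcShift_spec hp hn hq h0 hs huv hu hv
    exact segment_subset_vanishingCone h0 hs h1 h2 huv hu hv h3 h4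

/-! ### Greedy subtraction of quadratic polynomials -/

/-- Given finitely many nonzero nonnegative functions `T` in `U`, one can continuously subtract
nonnegative combinations of them from any `h ≥ 0`, keeping it nonnegative, until `h` has a zero in
the support of each `T`: the `T` are treated one after another, and zeros are never lost. -/
theorem exists_continuous_greedy_subtraction {V : Type*} [Fintype V] (U : Submodule ℝ (V → ℝ))
    (l : List (V → ℝ)) (hl : ∀ T ∈ l, T ∈ U ∧ 0 ≤ T ∧ T ≠ 0) :
    ∃ r : (V → ℝ) → V → ℝ, Continuous r ∧ ∀ h, 0 ≤ h → 0 ≤ r h ∧ r h ≤ h ∧ r h - h ∈ U ∧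
      ∀ T ∈ l, ∃ j, 0 < T j ∧ r h j = 0 := by
  classical
  induction l with
  | nil => exact ⟨id, continuous_id, fun h h0 ↦ ⟨h0, le_rfl, by simp, by simp⟩⟩
  | cons T l ih =>
    obtain ⟨r, hrc, hr⟩ := ih fun S hS ↦ hl S (List.mem_cons_of_mem T hS)
    obtain ⟨hTU, hT0, hT⟩ := hl T List.mem_cons_self
    let F : Finset V := Finset.univ.filter fun j ↦ 0 < T j
    have hF : F.Nonempty := by
      obtain ⟨j, hj⟩ := Function.ne_iff.1 hT
      exact ⟨j, Finset.mem_filter.2 ⟨Finset.mem_univ j, (hT0 j).lt_of_ne' hj⟩⟩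
    let c : (V → ℝ) → ℝ := fun h ↦ F.inf' hF fun j ↦ h j / T j
    have hcc : Continuous c :=
      Continuous.finset_inf'_apply _ fun j _ ↦ (continuous_apply j).div_const _
    have hc0 : ∀ h, 0 ≤ h → 0 ≤ c h := fun h h0 ↦
      Finset.le_inf' _ _ fun j _ ↦ div_nonneg (h0 j) (hT0 j)
    refine ⟨fun h ↦ r h - c (r h) • T, hrc.sub ((hcc.comp hrc).smul continuous_const), ?_⟩
    intro h h0
    obtain ⟨h1, h2, h3, h4⟩ := hr h h0
    have hcT : 0 ≤ c (r h) • T := smul_nonneg (hc0 _ h1) hT0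
    have hle : r h - c (r h) • T ≤ r h := sub_le_self _ hcT
    have hpos : 0 ≤ r h - c (r h) • T := by
      intro j
      rcases (hT0 j).eq_or_lt with hj | hj
      · simpa [← hj] using h1 j
      · have hj' : c (r h) ≤ r h j / T j :=
          Finset.inf'_le _ (Finset.mem_filter.2 ⟨Finset.mem_univ j, hj⟩)
        rw [le_div_iff₀ hj] at hj'
        simpa using hj'
    refine ⟨hpos, hle.trans h2, ?_, ?_⟩
    · rw [sub_right_comm]
      exact U.sub_mem h3 (U.smul_mem _ hTU)
    · intro S hS
      rcases List.mem_cons.1 hS with rfl | hS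
      · obtain ⟨j, hjF, hj⟩ := Finset.exists_mem_eq_inf' hF fun j ↦ r h j / S j
        have hSj : 0 < S j := (Finset.mem_filter.1 hjF).2
        refine ⟨j, hSj, ?_⟩
        change r h j - (F.inf' hF fun j ↦ r h j / S j) * S j = 0
        rw [hj, div_mul_cancel₀ _ hSj.ne', sub_self]
      · obtain ⟨j, hSj, hj⟩ := h4 S hS
        refine ⟨j, hSj, le_antisymm ?_ (hpos j)⟩
        rw [← hj]
        exact hle j

/-- The polynomial function `j ↦ a₀ + a₁ j + a₂ j²` on `{0, …, n - 1}`, linear in its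
coefficients. -/
def quadraticMap (n : ℕ) : (Fin 3 → ℝ) →ₗ[ℝ] (Fin n → ℝ) where
  toFun a j := a 0 + a 1 * j + a 2 * (j : ℝ) ^ 2
  map_add' a b := by
    ext j
    simp only [Pi.add_apply]
    ring
  map_smul' c a := by
    ext j
    simp only [Pi.smul_apply, smul_eq_mul, RingHom.id_apply]
    ring

theorem finrank_range_quadraticMap {n : ℕ} (hn : 3 ≤ n) :
    Module.finrank ℝ (LinearMap.range (quadraticMap n)) = 3 := by
  rw [LinearMap.finrank_range_of_inj, Module.finrank_fin_fun]
  rw [← LinearMap.ker_eq_bot, LinearMap.ker_eq_bot']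
  intro a ha
  have h0 := congr_fun ha ⟨0, by omega⟩
  have h1 := congr_fun ha ⟨1, by omega⟩
  have h2 := congr_fun ha ⟨2, by omega⟩
  simp only [quadraticMap, LinearMap.coe_mk, AddHom.coe_mk, Pi.zero_apply] at h0 h1 h2
  norm_num at h0 h1 h2
  ext i
  fin_cases i <;> simp <;> linarith

theorem const_mem_range_quadraticMap (n : ℕ) (c : ℝ) :
    (fun _ ↦ c) ∈ LinearMap.range (quadraticMap n) :=
  ⟨![c, 0, 0], by ext j; simp [quadraticMap]⟩

/-- A quadratic polynomial, nonnegative on `{0, …, n - 1}`, whose zeros there are the ends of the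
edge from `i` to its cyclic successor; the second case is the edge from `n - 1` to `0`. -/
def edgeQuadratic {n : ℕ} (i : Fin n) : Fin n → ℝ := fun j ↦
  if (i : ℕ) + 1 < n then ((j : ℝ) - i) * ((j : ℝ) - (i + 1)) else (j : ℝ) * (i - j)

theorem edgeQuadratic_mem_range {n : ℕ} (i : Fin n) :
    edgeQuadratic i ∈ LinearMap.range (quadraticMap n) := by
  by_cases hi : (i : ℕ) + 1 < n
  · refine ⟨![i * (i + 1), -(2 * i + 1), 1], ?_⟩
    ext j
    simp [quadraticMap, edgeQuadratic, hi]
    ring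
  · refine ⟨![0, i, -1], ?_⟩
    ext j
    simp [quadraticMap, edgeQuadratic, hi]
    ring

theorem edgeQuadratic_nonneg {n : ℕ} (i : Fin n) : 0 ≤ edgeQuadratic i := by
  intro j
  have hj := j.2
  simp only [Pi.zero_apply, edgeQuadratic]
  split_ifs with hi
  · rcases Nat.lt_or_ge i j with h | h
    · have : (i : ℝ) + 1 ≤ j := by exact_mod_cast h
      exact mul_nonneg (by linarith) (by linarith)
    · have : (j : ℝ) ≤ i := by exact_mod_cast h
      exact mul_nonneg_of_nonpos_of_nonpos (by linarith) (by linarith)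
  · have : (j : ℝ) ≤ i := by exact_mod_cast (show (j : ℕ) ≤ i by omega)
    exact mul_nonneg (by positivity) (by linarith)

theorem edgeQuadratic_eq_zero_iff {n : ℕ} (i j : Fin n) :
    edgeQuadratic i j = 0 ↔ clockwiseDist i j ≤ 1 := by
  have hi' := i.2
  have hj := j.2
  simp only [edgeQuadratic]
  split_ifs with hi
  · rw [mul_eq_zero, sub_eq_zero, sub_eq_zero]
    norm_cast
    unfold clockwiseDist
    split_ifs <;> omega
  · rw [mul_eq_zero, sub_eq_zero]
    norm_cast
    unfold clockwiseDist
    split_ifs <;> omega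

/-- A quadratic polynomial with zeros `u < v` is a multiple of `(j - u) (j - v)`. If `u` and `v` are
not neighbours on the cycle, this takes both signs on `{0, …, n - 1}`. -/
theorem eq_zero_of_mem_range_quadraticMap {n : ℕ} {h : Fin n → ℝ}
    (hU : h ∈ LinearMap.range (quadraticMap n)) (h0 : 0 ≤ h) {u v : Fin n}
    (huv : CyclicallyFar 1 u v) (hu : h u = 0) (hv : h v = 0) : h = 0 := by
  wlog hlt : (u : ℕ) < v generalizing u v
  · refine this huv.symm hv hu ?_
    obtain ⟨h1, -⟩ := huv
    unfold clockwiseDist at h1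
    split_ifs at h1 <;> omega
  obtain ⟨a, rfl⟩ := hU
  have hun := u.2
  have hvn := v.2
  obtain ⟨h1, h2⟩ := huv
  have hlt2 : (u : ℕ) + 1 < v := by
    unfold clockwiseDist at h1
    split_ifs at h1 <;> omega
  have hR : (u : ℝ) + 1 < v := by exact_mod_cast hlt2
  simp only [quadraticMap, LinearMap.coe_mk, AddHom.coe_mk] at hu hv
  have e1 : a 1 = -a 2 * (u + v) := by
    have : ((v : ℝ) - u) * (a 1 + a 2 * (u + v)) = 0 := by linear_combination hv - hu
    rcases mul_eq_zero.1 this with H | H <;> linarith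
  have fac : ∀ j : Fin n, quadraticMap n a j = a 2 * ((j - u) * (j - v)) := by
    intro j
    simp only [quadraticMap, LinearMap.coe_mk, AddHom.coe_mk]
    rw [e1] at hu ⊢
    linear_combination hu
  -- Evaluate strictly between the zeros, then strictly outside of them.
  have ha_nonpos : a 2 ≤ 0 := by
    have := h0 ⟨u + 1, by omega⟩
    rw [fac] at this
    push_cast at this
    simp only [Pi.zero_apply, add_sub_cancel_left, one_mul] at this
    nlinarith
  have ha_nonneg : 0 ≤ a 2 := by
    rcases Nat.eq_zero_or_pos u with hu0 | hu0
    · have hvn' : (v : ℕ) + 1 < n := by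
        unfold clockwiseDist at h2
        split_ifs at h2 <;> omega
      have := h0 ⟨v + 1, hvn'⟩
      rw [fac] at this
      push_cast at this
      simp only [Pi.zero_apply, add_sub_cancel_left, mul_one] at this
      nlinarith
    · have hu1 : (0 : ℝ) < u := by exact_mod_cast hu0
      have := h0 ⟨0, by omega⟩
      rw [fac] at this
      simp only [Pi.zero_apply, Nat.cast_zero, zero_sub, neg_mul_neg] at this
      exact nonneg_of_mul_nonneg_left this (by nlinarith)
  ext j
  rw [fac, le_antisymm ha_nonpos ha_nonneg, zero_mul, Pi.zero_apply]

theorem exists_cyclicallyFar_one {n : ℕ} (hn : 4 ≤ n) {Z : Set (Fin n)}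
    (hZ : ∀ i, ∃ j ∈ Z, 1 < clockwiseDist i j) :
    ∃ u ∈ Z, ∃ v ∈ Z, CyclicallyFar 1 u v := by
  obtain ⟨u, hu, -⟩ := hZ ⟨0, by omega⟩
  obtain ⟨v, hv, huv⟩ := hZ u
  obtain ⟨w, hw, hvw⟩ := hZ v
  by_cases h1 : CyclicallyFar 1 u v
  · exact ⟨u, hu, v, hv, h1⟩
  by_cases h2 : CyclicallyFar 1 v w
  · exact ⟨v, hv, w, hw, h2⟩
  by_cases h3 : CyclicallyFar 1 u w
  · exact ⟨u, hu, w, hw, h3⟩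
  exfalso
  have := u.2
  have := v.2
  have := w.2
  unfold CyclicallyFar at *
  unfold clockwiseDist at *
  split_ifs at * <;> omega

theorem sum_pos_of_nonneg_of_ne_zero {V : Type*} [Fintype V] {h : V → ℝ} (h0 : 0 ≤ h)
    (hne : h ≠ 0) : 0 < ∑ v, h v := by
  obtain ⟨j, hj⟩ := Function.ne_iff.1 hne
  exact Finset.sum_pos' (fun i _ ↦ h0 i) ⟨j, Finset.mem_univ j, (h0 j).lt_of_ne' hj⟩

/-- The inverse of the inclusion is the greedy subtraction of the `edgeQuadratic`s. The result stays
in the class of `h` modulo `U`, so it does not vanish identically. -/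
theorem nonempty_vanishingCone_cyclicallyFar_one_homotopyEquiv {n : ℕ} (hn : 4 ≤ n) :
    Nonempty (vanishingCone (CyclicallyFar (n := n) 1) ≃ₕ
      {h : Fin n → ℝ | 0 ≤ h ∧ h ∉ LinearMap.range (quadraticMap n)}) := by
  set U := LinearMap.range (quadraticMap n) with hU
  obtain ⟨r, hrc, hr⟩ := exists_continuous_greedy_subtraction U
    (List.ofFn fun i : Fin n ↦ edgeQuadratic i) (by
      intro T hT
      obtain ⟨i, rfl⟩ := List.mem_ofFn.1 hT
      refine ⟨edgeQuadratic_mem_range i, edgeQuadratic_nonneg i, fun H ↦ ?_⟩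
      obtain ⟨j, hj⟩ := exists_clockwiseDist_eq i (k := 2) (by omega)
      have := (edgeQuadratic_eq_zero_iff i j).1 (congr_fun H j)
      omega)
  have hincl : ∀ h ∈ vanishingCone (CyclicallyFar (n := n) 1), h ∉ U := by
    rintro h ⟨h0, hs, u, v, huv, hu, hv⟩ hmem
    rw [eq_zero_of_mem_range_quadraticMap hmem h0 huv hu hv] at hs
    simp at hs
  have hmaps : ∀ h, 0 ≤ h → h ∉ U → r h ∈ vanishingCone (CyclicallyFar (n := n) 1) := by
    intro h h0 hh
    obtain ⟨h1, h2, h3, h4⟩ := hr h h0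
    obtain ⟨u, hu, v, hv, huv⟩ := exists_cyclicallyFar_one hn (Z := {j | r h j = 0}) (by
      intro i
      obtain ⟨j, hj, hj'⟩ := h4 (edgeQuadratic i) (List.mem_ofFn.2 ⟨i, rfl⟩)
      refine ⟨j, hj', ?_⟩
      by_contra! H
      exact hj.ne' ((edgeQuadratic_eq_zero_iff i j).2 H))
    refine ⟨h1, sum_pos_of_nonneg_of_ne_zero h1 fun H ↦ hh ?_, u, v, huv, hu, hv⟩
    rw [H, zero_sub] at h3
    exact U.neg_mem_iff.1 h3
  refine nonempty_homotopyEquiv_of_segment_subset (f := id) (g := r) continuousOn_id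
    hrc.continuousOn (fun h hh ↦ ⟨hh.1, hincl h hh⟩) (fun h hh ↦ hmaps h hh.1 hh.2) ?_ ?_
  · intro h hh
    have hrh := hmaps h hh.1 (hincl h hh)
    have hle := (hr h hh.1).2.1
    obtain ⟨h0, hs, u, v, huv, hu, hv⟩ := hh
    exact segment_subset_vanishingCone h0 hs hrh.1 hrh.2.1 huv hu hv
      (le_antisymm (hu ▸ hle u) (hrh.1 u)) (le_antisymm (hv ▸ hle v) (hrh.1 v))
  · rintro h ⟨h0, hh⟩
    obtain ⟨h1, -, h3, -⟩ := hr h h0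
    exact Set.subset_inter ((convex_Ici (0 : Fin n → ℝ)).segment_subset h0 h1)
      (segment_subset_compl_of_sub_mem hh h3)

theorem nonempty_nonneg_homotopyEquiv_compl {V : Type*} [Fintype V] {U : Submodule ℝ (V → ℝ)}
    (hU : ∀ c : ℝ, (fun _ ↦ c) ∈ U) :
    Nonempty ({h : V → ℝ | 0 ≤ h ∧ h ∉ U} ≃ₕ {h : V → ℝ | h ∉ U}) := by
  have hmem : ∀ h : V → ℝ, (h + fun _ ↦ ‖h‖) - h ∈ U := fun h ↦ by
    rw [add_sub_cancel_left]
    exact hU _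
  have hadd : ∀ h : V → ℝ, h ∉ U → (h + fun _ ↦ ‖h‖) ∉ U := fun h hh H ↦
    hh ((U.add_mem_iff_left (hU _)).1 H)
  have hnn : ∀ h : V → ℝ, 0 ≤ h + fun _ ↦ ‖h‖ := fun h j ↦ by
    have := (abs_le.1 ((Real.norm_eq_abs _).symm.le.trans (norm_le_pi_norm h j))).1
    simp only [Pi.zero_apply, Pi.add_apply]
    linarith
  refine nonempty_homotopyEquiv_of_segment_subset (f := id) (g := fun h ↦ h + fun _ ↦ ‖h‖)
    continuousOn_id (by fun_prop) (fun h hh ↦ hh.2) (fun h hh ↦ ⟨hnn h, hadd h hh⟩) ?_ ?_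
  · rintro h ⟨h0, hh⟩
    exact Set.subset_inter ((convex_Ici (0 : V → ℝ)).segment_subset h0 (hnn h))
      (segment_subset_compl_of_sub_mem hh (hmem h))
  · intro h hh
    exact segment_subset_compl_of_sub_mem hh (hmem h)

theorem nonempty_vanishingCone_cyclicallyFar_homotopyEquiv_unitSphere {n p : ℕ} (hp : 1 ≤ p)
    (hn : 4 ≤ n) (hnp : 3 * p + 1 ≤ n) :
    Nonempty (vanishingCone (CyclicallyFar (n := n) p) ≃ₕ unitSphere (n - 4)) := by
  induction p, hp using Nat.le_induction with
  | base =>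
    refine nonempty_homotopyEquiv_trans
      (nonempty_vanishingCone_cyclicallyFar_one_homotopyEquiv hn)
      (nonempty_homotopyEquiv_trans
        (nonempty_nonneg_homotopyEquiv_compl (const_mem_range_quadraticMap n))
        (nonempty_compl_submodule_homotopyEquiv_unitSphere _ _ ?_))
    rw [finrank_range_quadraticMap (by omega), Fintype.card_fin]
    omega
  | succ p hp ih =>
    exact nonempty_homotopyEquiv_trans (nonempty_vanishingCone_cyclicallyFar_succ hp hnp)
      (ih (by omega))

/-! ### Antipodal pairs -/

/-- The sums of the values of `h` at pairs of antipodes of the cycle of length `2 p + 2`. -/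
noncomputable def foldAntipodes (p : ℕ) (h : Fin (2 * p + 2) → ℝ) : Fin (p + 1) → ℝ := fun i ↦
  h ⟨i, by omega⟩ + h ⟨i + (p + 1), by omega⟩

/-- Subtract its minimum from `y`, place the result on the first half of the cycle of length
`2 p + 2`, and extend by zero. -/
noncomputable def subMinExtend (p : ℕ) (y : Fin (p + 1) → ℝ) : Fin (2 * p + 2) → ℝ := fun j ↦
  if hj : (j : ℕ) < p + 1 then y ⟨j, hj⟩ - Finset.univ.inf' Finset.univ_nonempty y else 0

theorem cyclicallyFar_two_mul_add_two_iff {p : ℕ} (u v : Fin (2 * p + 2)) :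
    CyclicallyFar p u v ↔ (u : ℕ) + (p + 1) = v ∨ (v : ℕ) + (p + 1) = u := by
  have := u.2
  have := v.2
  unfold CyclicallyFar clockwiseDist
  split_ifs <;> omega

theorem subMinExtend_antipode {p : ℕ} (y : Fin (p + 1) → ℝ) (i : Fin (p + 1)) :
    subMinExtend p y ⟨i + (p + 1), by omega⟩ = 0 :=
  dif_neg (by simp only; omega)

theorem foldAntipodes_subMinExtend {p : ℕ} (y : Fin (p + 1) → ℝ) :
    foldAntipodes p (subMinExtend p y) =
      y - fun _ ↦ Finset.univ.inf' Finset.univ_nonempty y := by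
  ext i
  have hi : (i : ℕ) < p + 1 := i.2
  rw [foldAntipodes, subMinExtend_antipode]
  simp [subMinExtend, hi]

theorem mem_span_one_iff {V : Type*} {y : V → ℝ} :
    y ∈ Submodule.span ℝ {(1 : V → ℝ)} ↔ ∃ c : ℝ, y = fun _ ↦ c := by
  rw [Submodule.mem_span_singleton]
  refine exists_congr fun c ↦ ⟨fun h ↦ ?_, fun h ↦ ?_⟩
  · rw [← h]
    ext j
    simp
  · rw [h]
    ext j
    simp

/-- On the cone, sums over antipodal pairs have minimum `0`, so folding and then extending moves `h`
along functions that vanish at a common antipodal pair. -/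
theorem nonempty_vanishingCone_antipodal_homotopyEquiv {p : ℕ} :
    Nonempty (vanishingCone (CyclicallyFar (n := 2 * p + 2) p) ≃ₕ
      {y : Fin (p + 1) → ℝ | y ∉ Submodule.span ℝ {(1 : Fin (p + 1) → ℝ)}}) := by
  have hmin : ∀ h ∈ vanishingCone (CyclicallyFar (n := 2 * p + 2) p),
      ∃ i : Fin (p + 1), h ⟨i, by omega⟩ = 0 ∧ h ⟨i + (p + 1), by omega⟩ = 0 := by
    rintro h ⟨h0, hs, u, v, huv, hu, hv⟩
    have := u.2
    have := v.2
    rcases (cyclicallyFar_two_mul_add_two_iff u v).1 huv with H | H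
    · refine ⟨⟨u, by omega⟩, hu, ?_⟩
      convert hv
    · refine ⟨⟨v, by omega⟩, hv, ?_⟩
      convert hu
  have hfold0 : ∀ h, 0 ≤ h → 0 ≤ foldAntipodes p h := fun h h0 i ↦ add_nonneg (h0 _) (h0 _)
  have hinf : ∀ h ∈ vanishingCone (CyclicallyFar (n := 2 * p + 2) p),
      Finset.univ.inf' Finset.univ_nonempty (foldAntipodes p h) = 0 := by
    intro h hh
    obtain ⟨i, hi, hi'⟩ := hmin h hh
    refine le_antisymm ?_ (Finset.le_inf' _ _ fun j _ ↦ hfold0 h hh.1 j)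
    refine (Finset.inf'_le _ (Finset.mem_univ i)).trans ?_
    simp [foldAntipodes, hi, hi']
  have hf : ∀ h ∈ vanishingCone (CyclicallyFar (n := 2 * p + 2) p),
      foldAntipodes p h ∉ Submodule.span ℝ {(1 : Fin (p + 1) → ℝ)} := by
    intro h hh hmem
    obtain ⟨c, hc⟩ := mem_span_one_iff.1 hmem
    obtain rfl : c = 0 := by
      have := hinf h hh
      rw [hc] at this
      simpa using this
    refine hh.2.1.ne' (Finset.sum_eq_zero fun j _ ↦ ?_)
    have hj := j.2
    by_cases hjp : (j : ℕ) < p + 1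
    · have h1 : h j + h ⟨j + (p + 1), by omega⟩ = 0 := congr_fun hc ⟨j, hjp⟩
      have h2 := hh.1 j
      have h3 := hh.1 ⟨j + (p + 1), by omega⟩
      simp only [Pi.zero_apply] at h2 h3
      linarith
    · have h1 : h ⟨j - (p + 1), by omega⟩ + h ⟨j - (p + 1) + (p + 1), by omega⟩ = 0 :=
        congr_fun hc ⟨j - (p + 1), by omega⟩
      have h4 : (⟨j - (p + 1) + (p + 1), by omega⟩ : Fin (2 * p + 2)) = j := by
        ext
        simp only
        omega
      rw [h4] at h1
      have h2 := hh.1 j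
      have h3 := hh.1 ⟨j - (p + 1), by omega⟩
      simp only [Pi.zero_apply] at h2 h3
      linarith
  have hg : ∀ y : Fin (p + 1) → ℝ, y ∉ Submodule.span ℝ {(1 : Fin (p + 1) → ℝ)} →
      subMinExtend p y ∈ vanishingCone (CyclicallyFar (n := 2 * p + 2) p) := by
    intro y hy
    have h0 : 0 ≤ subMinExtend p y := by
      intro j
      simp only [Pi.zero_apply, subMinExtend]
      split_ifs with hj
      · exact sub_nonneg.2 (Finset.inf'_le _ (Finset.mem_univ _))
      · exact le_rfl
    obtain ⟨i, -, hi⟩ := Finset.exists_mem_eq_inf' Finset.univ_nonempty y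
    refine ⟨h0, sum_pos_of_nonneg_of_ne_zero h0 fun H ↦ hy ?_, ⟨i, by omega⟩,
      ⟨i + (p + 1), by omega⟩, (cyclicallyFar_two_mul_add_two_iff _ _).2 (Or.inl rfl), ?_, ?_⟩
    · refine mem_span_one_iff.2 ⟨Finset.univ.inf' Finset.univ_nonempty y, ?_⟩
      rw [← sub_eq_zero, ← foldAntipodes_subMinExtend, H]
      ext i
      simp [foldAntipodes]
    · have hi' : (i : ℕ) < p + 1 := i.2
      simp [subMinExtend, hi, hi']
    · exact subMinExtend_antipode _ _
  have hinfc : Continuous fun y : Fin (p + 1) → ℝ ↦ Finset.univ.inf' Finset.univ_nonempty y :=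
    Continuous.finset_inf'_apply _ fun j _ ↦ continuous_apply j
  refine nonempty_homotopyEquiv_of_segment_subset (f := foldAntipodes p) (g := subMinExtend p)
    ?_ ?_ hf hg ?_ ?_
  · refine Continuous.continuousOn (continuous_pi fun i ↦ ?_)
    exact (continuous_apply _).add (continuous_apply _)
  · refine Continuous.continuousOn (continuous_pi fun j ↦ ?_)
    unfold subMinExtend
    split_ifs with hj
    · exact (continuous_apply _).sub hinfc
    · exact continuous_const
  · intro h hh
    obtain ⟨i, hi, hi'⟩ := hmin h hh
    have hgf := hg _ (hf h hh)
    refine segment_subset_vanishingCone hh.1 hh.2.1 hgf.1 hgf.2.1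
      ((cyclicallyFar_two_mul_add_two_iff _ _).2 (Or.inl rfl)) hi hi' ?_ ?_
    · have hi' : (i : ℕ) < p + 1 := i.2
      simp_all [subMinExtend, foldAntipodes]
    · exact subMinExtend_antipode _ _
  · intro y hy
    refine segment_subset_compl_of_sub_mem hy ?_
    rw [foldAntipodes_subMinExtend, sub_sub_cancel_left]
    exact Submodule.neg_mem _ (mem_span_one_iff.2 ⟨_, rfl⟩)

theorem theorem3p7 (n p : ℕ) (hp : 1 ≤ p) (hn : 2 * p + 2 ≤ n) :
    (n = 2 * p + 2 →
      Nonempty (geometricRealization (totalCutComplex 2 ((SimpleGraph.cycleGraph n).pathPower p))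
        ≃ₕ unitSphere ((n - 4) / 2))) ∧
    (3 * p + 1 ≤ n →
      Nonempty (geometricRealization (totalCutComplex 2 ((SimpleGraph.cycleGraph n).pathPower p))
        ≃ₕ unitSphere (n - 4))) := by
  have hcone := nonempty_realization_homotopyEquiv_vanishingCone
    ((SimpleGraph.cycleGraph n).pathPower p)
  have hR : (fun u v ↦ u ≠ v ∧ ¬ ((SimpleGraph.cycleGraph n).pathPower p).Adj u v) =
      CyclicallyFar p := by
    ext u v
    exact ne_and_not_pathPower_adj_iff p u v
  rw [hR] at hcone
  refine ⟨?_, fun h ↦ nonempty_homotopyEquiv_trans hcone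
    (nonempty_vanishingCone_cyclicallyFar_homotopyEquiv_unitSphere hp (by omega) h)⟩
  rintro rfl
  refine nonempty_homotopyEquiv_trans hcone
    (nonempty_homotopyEquiv_trans nonempty_vanishingCone_antipodal_homotopyEquiv
      (nonempty_compl_submodule_homotopyEquiv_unitSphere _ _ ?_))
  rw [finrank_span_singleton one_ne_zero, Fintype.card_fin]
  omega
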